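/- A \emph{holomorphic circle action} $\gamma=(\gamma^t)_{t\in\mathbb R/\mathbb Z}$ is a faithful continuous action of the circle $\mathbb R/\mathbb Z$ on a connected open neighborhood $U_\gamma\subset\mathbb C$ of $0$ by biholomorphic maps $\gamma^t:U_\gamma\to U_\gamma$ with $\gamma^t(0)=0$; it is \emph{standard} if $\gamma^t(z)=e^{2\pi i t}z$. A pair $(\gamma^t,\rho^s)$ of holomorphic circle actions (possibly with different domains) is \emph{trivial} if there is a neighborhood of $0$ such that for each point $z$ of it the $\gamma$-orbit and the $\rho$-orbit of $z$ coincide, and \emph{non-trivial} otherwise. Let $h$ be a local homeomorphism near $0$, i.e. a homeomorphism from an open neighborhood of $0$ in $\mathbb C$ onto an open subset of $\mathbb C$. It is called \emph{$(\gamma,\tilde\gamma)$-equivariant} if either $h(\gamma^t z)=\tilde\gamma^{t}(h(z))$ for all $z$ in some neighborhood of $0$ and all $t$, or $h(\gamma^t z)=\tilde\gamma^{-t}(h(z))$ for all $z$ in some neighborhood of $0$ and all $t$ (in both cases with $h(z)\in U_{\tilde\gamma}$). Let $(\gamma^t,\rho^s)$ and $(\tilde\gamma^t,\tilde\rho^s)$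 be two non-trivial pairs of holomorphic circle actions, and let $h$ be a local homeomorphism near $0$ that is both $(\gamma,\tilde\gamma)$-equivariant and $(\rho,\tilde\rho)$-equivariant. Then $h$ is holomorphic or antiholomorphic in a neighborhood of $0$; if $h$ preserves orientation at $0$ (that is, for all sufficiently small $r>0$ the loop $t\mapsto h(re^{2\pi i t})$, $0\le t\le 1$, has winding number $+1$ around $h(0)$), then $h$ is holomorphic in a neighborhood of $0$. If moreover the actions $\gamma$ and $\tilde\gamma$ are standard, then there is $\lambda\in\mathbb C\setminus\{0\}$ such that $h(z)=\lambda z$ for all $z$ near $0$ or $h(z)=\lambda\bar z$ for all $z$ near $0$; if $h$ preserves orientation at $0$, then $h(z)=\lambda z$ near $0$. -/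

import Mathlib

open Filter Topology

/-- A holomorphic circle action: a connected open neighbourhood `domain` of `0` in `ℂ` together with
a faithful continuous action of the circle `ℝ/ℤ` on it by holomorphic maps fixing `0`. Each
`act t` is a biholomorphic map of `domain`, with inverse `act (-t)`. Values of `act t` outside
`domain` carry no meaning. -/
structure HolCircleAction where
  /-- the neighbourhood of `0` on which the circle acts -/
  domain : Set ℂ
  isOpen_domain : IsOpen domain
  isConnected_domain : IsConnected domain
  zero_mem : (0 : ℂ) ∈ domain
  /-- the maps `γ^t` of the action -/
  act : UnitAddCircle → ℂ → ℂ
  mapsTo : ∀ t, Set.MapsTo (act t) domain domain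
  act_zero : ∀ z ∈ domain, act 0 z = z
  act_add : ∀ s t, ∀ z ∈ domain, act (s + t) z = act s (act t z)
  holomorphic : ∀ t, DifferentiableOn ℂ (act t) domain
  continuousOn : ContinuousOn (fun p : UnitAddCircle × ℂ => act p.1 p.2) (Set.univ ×ˢ domain)
  fixes_zero : ∀ t, act t 0 = 0
  faithful : ∀ t, (∀ z ∈ domain, act t z = z) → t = 0

namespace HolCircleAction

/-- The orbit of the point `z`; for `z ≠ 0` in the domain it is a leaf of the foliation
associated with the action. -/
def orbit (γ : HolCircleAction) (z : ℂ) : Set ℂ := Set.range fun t => γ.act t z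

/-- The action is standard: `γ^t z = e^{2πit} z`. -/
def IsStandard (γ : HolCircleAction) : Prop :=
  ∀ (t : ℝ), ∀ z ∈ γ.domain,
    γ.act (t : UnitAddCircle) z = Complex.exp (2 * Real.pi * Complex.I * t) * z

/-- A pair of actions is trivial if their foliations by orbits coincide near `0`. -/
def TrivialPair (γ ρ : HolCircleAction) : Prop :=
  ∀ᶠ z in 𝓝 (0 : ℂ), γ.orbit z = ρ.orbit z

/-- A pair of actions is non-trivial if their foliations do not coincide near `0`. -/
def NontrivialPair (γ ρ : HolCircleAction) : Prop := ¬ TrivialPair γ ρ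

/-- `h` is `(γ, γ')`-equivariant near `0`: for all `z` near `0` and all `t`,
`h (γ^t z) = γ'^t (h z)`, or, for all `z` near `0` and all `t`, `h (γ^t z) = γ'^(-t) (h z)`.
It is understood that `h z` lies in the domain of `γ'`. -/
def Equivariant (γ γ' : HolCircleAction) (h : ℂ → ℂ) : Prop :=
  (∀ᶠ z in 𝓝 (0 : ℂ), h z ∈ γ'.domain ∧ ∀ t, h (γ.act t z) = γ'.act t (h z)) ∨
  (∀ᶠ z in 𝓝 (0 : ℂ), h z ∈ γ'.domain ∧ ∀ t, h (γ.act t z) = γ'.act (-t) (h z))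

end HolCircleAction

/-- `h` is holomorphic in a neighbourhood of `0`. -/
def HolomorphicNearZero (h : ℂ → ℂ) : Prop := ∀ᶠ z in 𝓝 (0 : ℂ), DifferentiableAt ℂ h z

/-- `h` is antiholomorphic in a neighbourhood of `0`. -/
def AntiholomorphicNearZero (h : ℂ → ℂ) : Prop :=
  HolomorphicNearZero fun z => (starRingEnd ℂ) (h z)

/-- A local homeomorphism `h` at `0` preserves orientation (has local degree `+1`): for all small
`r > 0`, the loop `t ↦ h (r e^{2πit})`, `0 ≤ t ≤ 1`, winds exactly `+1` times around `h 0`, that is,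
a continuous branch `θ` (measured in full turns) of the argument of `h (r e^{2πit}) - h 0`
increases by `1` along it. -/
def OrientationPreservingAtZero (h : ℂ → ℂ) : Prop :=
  ∀ᶠ r : ℝ in 𝓝[>] (0 : ℝ), ∃ θ : ℝ → ℝ, ContinuousOn θ (Set.Icc 0 1) ∧
    (∀ t : ℝ, t ∈ Set.Icc (0 : ℝ) 1 →
      h ((r : ℂ) * Complex.exp (2 * Real.pi * Complex.I * t)) - h 0 =
        ‖h ((r : ℂ) * Complex.exp (2 * Real.pi * Complex.I * t)) - h 0‖ *
          Complex.exp (2 * Real.pi * Complex.I * θ t)) ∧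
    θ 1 = θ 0 + 1

/-! Near a fixed point a circle action is holomorphically conjugate to rotations `z ↦ e^{±2πit}z`: a
suitable Fourier coefficient of `t ↦ γ^t z - p` is the coordinate (`exists_linearizes`). In such
coordinates for `γ` and `γ'`, and after a complex conjugation if the signs disagree, `h` becomes a
continuous map `H` that commutes with rotations, so `H z = z g(|z|²)`. The second action is
generated by a field `i z a(z)` and its counterpart in the target by `i σ z b(z)`, with `a`, `b`
holomorphic.

If `a` were real on a circle around `0`, it would be constant and the two actions would have the
same orbits. So every small circle is crossed transversally by some orbit of the second action;
since `H` carries flow to flow, `g` is differentiable at `r²`. Differentiating the equivariance on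
`|z| = r` gives `a g + g' r² (a - conj a) = σ g b(z g)`. If `g' ≠ 0`, then `conj a` has on the
circle the values of a function holomorphic in the disc, and again `a` is constant. Hence `g' = 0`
and `H` is linear (`eventually_eq_mul_of_equivariant`), so `h` is holomorphic or antiholomorphic; a
winding argument excludes the second case when orientation is preserved
(`not_orientationPreservingAtZero`). -/

/-! ### Holomorphic functions with constrained boundary values -/

/-- A holomorphic function on a disc that is real on the boundary circle is constant. -/
theorem eq_const_of_im_eq_zero_on_sphere {f : ℂ → ℂ} {r : ℝ} (hr : 0 < r)
    (hf : DiffContOnCl ℂ f (Metric.ball 0 r)) (him : ∀ z ∈ Metric.sphere (0 : ℂ) r, (f z).im = 0) :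
    ∀ z ∈ Metric.ball (0 : ℂ) r, f z = f 0 := by
  have hball : Bornology.IsBounded (Metric.ball (0 : ℂ) r) := Metric.isBounded_ball
  have hfr : frontier (Metric.ball (0 : ℂ) r) = Metric.sphere 0 r := frontier_ball _ hr.ne'
  -- `|exp(±i f)| = exp(∓ Im f)` is `1` on the circle, so the maximum principle for both signs gives
  -- `Im f = 0` inside.
  have hexp : ∀ c : ℂ, DiffContOnCl ℂ (fun z => Complex.exp (c * f z)) (Metric.ball 0 r) := fun c =>
    Complex.differentiable_exp.comp_diffContOnCl (hf.const_smul c)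
  have hre : ∀ z ∈ Metric.ball (0 : ℂ) r, (f z).im = 0 := by
    intro z hz
    have h1 := Complex.norm_le_of_forall_mem_frontier_norm_le hball (hexp Complex.I) (C := 1)
      (by intro w hw; rw [hfr] at hw; simp [Complex.norm_exp, him w hw]) (subset_closure hz)
    have h2 := Complex.norm_le_of_forall_mem_frontier_norm_le hball (hexp (-Complex.I)) (C := 1)
      (by intro w hw; rw [hfr] at hw; simp [Complex.norm_exp, him w hw]) (subset_closure hz)
    simp only [Complex.norm_exp, Real.exp_le_one_iff] at h1 h2
    simp at h1 h2
    linarith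
  have hmax : IsMaxOn (norm ∘ fun z => Complex.exp (Complex.I * f z)) (Metric.ball 0 r) 0 := by
    intro z hz
    simp [Complex.norm_exp, hre z hz, hre 0 (Metric.mem_ball_self hr)]
  have hconst := Complex.eqOn_of_isPreconnected_of_isMaxOn_norm (convex_ball _ _).isPreconnected
    Metric.isOpen_ball (hexp Complex.I).differentiableOn (Metric.mem_ball_self hr) hmax
  have hderiv : Set.EqOn (deriv f) 0 (Metric.ball 0 r) := by
    intro z hz
    have hz' := Metric.isOpen_ball.mem_nhds hz
    have hfz := (hf.differentiableOn.differentiableAt hz').hasDerivAt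
    have h1 := (hfz.const_mul Complex.I).cexp
    have h2 := (hasDerivAt_const z (Complex.exp (Complex.I * f 0))).congr_of_eventuallyEq
      (eventually_of_mem hz' fun w hw => hconst hw)
    have := h1.unique h2
    simpa using this
  intro z hz
  exact Metric.isOpen_ball.is_const_of_deriv_eq_zero (convex_ball _ _).isPreconnected
    hf.differentiableOn hderiv hz (Metric.mem_ball_self hr)

/-- If the conjugate of a holomorphic function on a disc has, on the boundary circle, the values of
another holomorphic function, then it is constant. -/
theorem eq_const_of_conj_eq_on_sphere {A B : ℂ → ℂ} {r : ℝ} (hr : 0 < r)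
    (hA : DiffContOnCl ℂ A (Metric.ball 0 r)) (hB : DiffContOnCl ℂ B (Metric.ball 0 r))
    (h : ∀ z ∈ Metric.sphere (0 : ℂ) r, (starRingEnd ℂ) (A z) = B z) :
    ∀ z ∈ Metric.ball (0 : ℂ) r, A z = A 0 := by
  intro z hz
  -- On the circle `A + B = 2 Re A` and `i (A - B) = -2 Im A` are both real.
  have h1 := eq_const_of_im_eq_zero_on_sphere hr (hA.add hB)
    (by intro w hw; simp [← h w hw]) z hz
  have h2 := eq_const_of_im_eq_zero_on_sphere hr ((hA.sub hB).const_smul Complex.I)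
    (by intro w hw; simp [← h w hw]) z hz
  simp only [Pi.add_apply, Pi.smul_apply, Pi.sub_apply, smul_eq_mul, mul_eq_mul_left_iff,
    Complex.I_ne_zero, or_false] at h1 h2
  linear_combination (h1 + h2) / 2

/-! ### The vector field generating the rotations in a coordinate -/

/-- The coefficient `a` of the holomorphic vector field `z a(z) ∂/∂z` that generates the rotations
in the coordinate `u`. -/
noncomputable def rotationField (u : ℂ → ℂ) (z : ℂ) : ℂ := dslope u 0 z / deriv u z

theorem AnalyticAt.rotationField {u : ℂ → ℂ} (hu : AnalyticAt ℂ u 0) (hu' : deriv u 0 ≠ 0) :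
    AnalyticAt ℂ (rotationField u) 0 := by
  refine AnalyticAt.div ?_ hu.deriv hu'
  obtain ⟨p, hp⟩ := hu
  exact hp.has_fpower_series_dslope_fslope.analyticAt

theorem mul_rotationField_mul_deriv {u : ℂ → ℂ} {z : ℂ} (hu0 : u 0 = 0) (hz : deriv u z ≠ 0) :
    z * rotationField u z * deriv u z = u z := by
  have := sub_smul_dslope u 0 z
  simp only [sub_zero, smul_eq_mul, hu0] at this
  rw [rotationField, mul_assoc, div_mul_cancel₀ _ hz, this]

/-- If the rotations in the coordinate `u` are the standard ones, then `u` is linear. -/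
theorem eventually_eq_mul_of_rotationField_eq_const {u : ℂ → ℂ} (hu : AnalyticAt ℂ u 0)
    (hu0 : u 0 = 0) (hu' : deriv u 0 ≠ 0) {r : ℝ} (hr : 0 < r)
    (ha : ∀ z ∈ Metric.ball (0 : ℂ) r, rotationField u z = rotationField u 0) :
    ∀ᶠ z in 𝓝 (0 : ℂ), u z = deriv u 0 * z := by
  -- The constant must be `1`, so `u z / z = u' z`, which says that `u z / z` has zero derivative
  -- away from `0`.
  have ha0 : rotationField u 0 = 1 := by rw [rotationField, dslope_same, div_self hu']
  obtain ⟨p, hp⟩ := id hu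
  have hq : AnalyticAt ℂ (dslope u 0) 0 := hp.has_fpower_series_dslope_fslope.analyticAt
  have hz0 : ∀ᶠ z in 𝓝 (0 : ℂ), z ≠ 0 → deriv (dslope u 0) z = 0 := by
    filter_upwards [Metric.ball_mem_nhds _ hr, hq.eventually_analyticAt,
      hu.deriv.continuousAt.eventually_ne hu', hu.eventually_analyticAt] with z hz hqz hz' huz hz0
    have h1 : u = fun w => w * dslope u 0 w := by
      ext w
      have := sub_smul_dslope u 0 w
      simp only [sub_zero, smul_eq_mul, hu0] at this
      exact this.symm
    have h2 : HasDerivAt (fun w => w * dslope u 0 w)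
        (1 * dslope u 0 z + z * deriv (dslope u 0) z) z :=
      (hasDerivAt_id z).mul hqz.differentiableAt.hasDerivAt
    have h3 : deriv u z = 1 * dslope u 0 z + z * deriv (dslope u 0) z := by
      conv_lhs => rw [h1]
      exact h2.deriv
    have h4 : dslope u 0 z = deriv u z := by
      have := ha z hz
      rw [ha0, rotationField, div_eq_one_iff_eq hz'] at this
      exact this
    rw [h4] at h3
    have : z * deriv (dslope u 0) z = 0 := by linear_combination -h3
    exact (mul_eq_zero.1 this).resolve_left hz0
  obtain ⟨ε, hε, hball⟩ := Metric.eventually_nhds_iff_ball.1 (hz0.and hq.eventually_analyticAt)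
  have hd : DifferentiableOn ℂ (dslope u 0) (Metric.ball 0 ε) := fun z hz =>
    (hball z hz).2.differentiableAt.differentiableWithinAt
  -- The factor `z` gives no information at the origin; isolation of zeros fills the gap.
  have h00 : deriv (dslope u 0) 0 = 0 := by
    have h1 : ∀ᶠ z in 𝓝[≠] (0 : ℂ), deriv (dslope u 0) z = 0 := eventually_nhdsWithin_iff.2 hz0
    exact ((hq.deriv).eventually_eq_zero_or_eventually_ne_zero.resolve_right fun h2 =>
      ((h1.and h2).exists.elim fun z hz => hz.2 hz.1)).self_of_nhds
  filter_upwards [Metric.ball_mem_nhds _ hε] with z hz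
  have := Metric.isOpen_ball.is_const_of_deriv_eq_zero (convex_ball _ _).isPreconnected hd
    (fun w hw => by
      by_cases hw0 : w = 0
      · rw [hw0]; exact h00
      · exact (hball w hw).1 hw0) hz (Metric.mem_ball_self hε)
  have h5 := sub_smul_dslope u 0 z
  simp only [sub_zero, smul_eq_mul, hu0, this, dslope_same] at h5
  rw [← h5, mul_comm]

/-- The rotations in the coordinate `u` are generated by the vector field `i z a(z) ∂/∂z`, where
`a = rotationField u`. -/
theorem eventually_hasStrictDerivAt_rotation {u χ : ℂ → ℂ} (hu : AnalyticAt ℂ u 0)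
    (hu0 : u 0 = 0) (hu' : deriv u 0 ≠ 0) (hχ : AnalyticAt ℂ χ 0)
    (hχu : ∀ᶠ z in 𝓝 (0 : ℂ), χ (u z) = z) (σ : ℝ) :
    ∀ᶠ z in 𝓝 (0 : ℂ), HasStrictDerivAt (fun s : ℝ => χ (Complex.exp (Complex.I * σ * s) * u z))
      (Complex.I * σ * z * rotationField u z) 0 := by
  have hχ' : ∀ᶠ z in 𝓝 (0 : ℂ), AnalyticAt ℂ χ (u z) := by
    have : Tendsto u (𝓝 0) (𝓝 0) := by simpa [hu0] using hu.continuousAt.tendsto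
    exact this.eventually hχ.eventually_analyticAt
  filter_upwards [hχ', hχu.eventually_nhds, hu.deriv.continuousAt.eventually_ne hu',
    hu.eventually_analyticAt] with z h1 h2 h3 h4
  have hinv : deriv χ (u z) * deriv u z = 1 := by
    have h5 : HasDerivAt (fun w => χ (u w)) (deriv χ (u z) * deriv u z) z :=
      h1.differentiableAt.hasDerivAt.comp z h4.differentiableAt.hasDerivAt
    exact h5.unique ((hasDerivAt_id z).congr_of_eventuallyEq h2)
  have h5 : HasStrictDerivAt (fun s : ℂ => Complex.exp (Complex.I * σ * s) * u z)
      (Complex.I * σ * u z) 0 := by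
    have := (((hasStrictDerivAt_id (0 : ℂ)).const_mul (Complex.I * σ)).cexp).mul_const (u z)
    simpa using this
  have h6 : HasStrictDerivAt (fun s : ℂ => χ (Complex.exp (Complex.I * σ * s) * u z))
      (deriv χ (u z) * (Complex.I * σ * u z)) ((0 : ℝ) : ℂ) := by
    refine HasStrictDerivAt.comp (h₂ := χ) ((0 : ℝ) : ℂ) ?_ ?_
    · simpa using h1.hasStrictDerivAt
    · simpa using h5
  have h7 : deriv χ (u z) * (Complex.I * σ * u z) = Complex.I * σ * z * rotationField u z := by
    have h8 := mul_rotationField_mul_deriv hu0 h3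
    linear_combination (Complex.I * σ * z * rotationField u z) * hinv -
      Complex.I * σ * deriv χ (u z) * h8
  rw [h7] at h6
  have h8 : HasStrictDerivAt (fun s : ℝ => (s : ℂ)) 1 0 := by
    have := Complex.ofRealCLM.hasStrictFDerivAt.hasStrictDerivAt (x := (0 : ℝ))
    rwa [Complex.ofRealCLM_apply, Complex.ofReal_one] at this
  simpa [Function.comp_def] using HasStrictDerivAt.scomp (𝕜' := ℂ) (0 : ℝ) h6 h8

/-! ### Rigidity in linearized coordinates -/

/-- A map that commutes with the rotations and maps the rotations in a non-linear coordinate `u`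
to the rotations in a coordinate `v` is linear near `0`. Here `χ` and `ω` are local inverses of `u`
and `v`. -/
theorem eventually_eq_mul_of_equivariant {H u v χ ω : ℂ → ℂ} {σ : ℝ}
    (hHc : ContinuousAt H 0)
    (hrot : ∀ᶠ z in 𝓝 (0 : ℂ), ∀ x : ℝ, H (Complex.exp (Complex.I * x) * z) =
      Complex.exp (Complex.I * x) * H z)
    (hu : AnalyticAt ℂ u 0) (hu0 : u 0 = 0) (hu' : deriv u 0 ≠ 0) (hχ : AnalyticAt ℂ χ 0)
    (hχu : ∀ᶠ z in 𝓝 (0 : ℂ), χ (u z) = z)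
    (hv : AnalyticAt ℂ v 0) (hv0 : v 0 = 0) (hv' : deriv v 0 ≠ 0) (hω : AnalyticAt ℂ ω 0)
    (hωv : ∀ᶠ z in 𝓝 (0 : ℂ), ω (v z) = z)
    (hflow : ∀ᶠ z in 𝓝 (0 : ℂ), ∀ s : ℝ, H (χ (Complex.exp (Complex.I * s) * u z)) =
      ω (Complex.exp (Complex.I * σ * s) * v (H z)))
    (hnl : ¬ ∃ c : ℂ, ∀ᶠ z in 𝓝 (0 : ℂ), u z = c * z) :
    ∃ c : ℂ, ∀ᶠ z in 𝓝 (0 : ℂ), H z = c * z := by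
  have hH0 : H 0 = 0 := by
    have := hrot.self_of_nhds Real.pi
    rw [mul_zero, mul_comm Complex.I, Complex.exp_pi_mul_I] at this
    linear_combination this / 2
  have hHt : Tendsto H (𝓝 0) (𝓝 0) := by simpa [hH0] using hHc.tendsto
  have hZ := eventually_hasStrictDerivAt_rotation hu hu0 hu' hχ hχu 1
  have hW := hHt.eventually (eventually_hasStrictDerivAt_rotation hv hv0 hv' hω hωv σ)
  obtain ⟨R', hR', hb⟩ := Metric.eventually_nhds_iff_ball.1
    (hv.rotationField hv').eventually_analyticAt
  obtain ⟨R, hR, hball⟩ := Metric.eventually_nhds_iff_ball.1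
    (hrot.and <| hflow.and <| hZ.and <| hW.and <| (hu.rotationField hu').eventually_analyticAt.and <|
      (hHt.eventually (Metric.ball_mem_nhds _ hR')).and <| hχu.and (hHt.eventually hωv))
  set a := rotationField u
  set b := rotationField v
  -- Commuting with rotations makes `H z / z` a function of `|z|` alone; the variable `x = |z|²` is
  -- used because it is smooth along the flow.
  set g : ℝ → ℂ := fun x => H (√x : ℝ) / (√x : ℝ) with hg
  have hanc : ∀ r, 0 < r → ¬ ∀ z ∈ Metric.ball (0 : ℂ) r, a z = a 0 := fun r hr h =>
    hnl ⟨_, eventually_eq_mul_of_rotationField_eq_const hu hu0 hu' hr h⟩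
  have hda : ∀ r < R, DiffContOnCl ℂ a (Metric.ball 0 r) := fun r hr =>
    DifferentiableOn.diffContOnCl fun z hz => by
      refine ((hball z ?_).2.2.2.2.1).differentiableAt.differentiableWithinAt
      exact Metric.closedBall_subset_ball hr (Metric.closure_ball_subset_closedBall hz)
  have hHg : ∀ z ∈ Metric.ball (0 : ℂ) R, H z = z * g (‖z‖ ^ 2) := by
    intro z hz
    rcases eq_or_ne z 0 with rfl | hz0
    · simp [hH0]
    have hzn : (‖z‖ : ℂ) ≠ 0 := by simpa using hz0
    have h1 : z = Complex.exp (Complex.I * (z.arg : ℝ)) * ‖z‖ := by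
      rw [mul_comm, mul_comm Complex.I, Complex.norm_mul_exp_arg_mul_I]
    have h2 := (hball (‖z‖ : ℂ) (by simpa using hz)).1 z.arg
    rw [← h1] at h2
    simp only [hg, Real.sqrt_sq (norm_nonneg z)]
    rw [h2, mul_div_assoc', eq_div_iff hzn]
    nth_rw 4 [h1]
    ring
  have hderiv : ∀ r, 0 < r → r < R → HasDerivAt g 0 (r ^ 2) := by
    intro r hr hrR
    have hsph : ∀ z ∈ Metric.sphere (0 : ℂ) r, z ∈ Metric.ball (0 : ℂ) R ∧ z ≠ 0 ∧ ‖z‖ = r := by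
      intro z hz
      have hzr : ‖z‖ = r := by simpa using hz
      refine ⟨by simp [hzr, hrR], ?_, hzr⟩
      rintro rfl
      simp at hzr
      exact hr.ne hzr
    -- the flow through a point of the circle and its squared modulus
    have hflowz : ∀ z ∈ Metric.sphere (0 : ℂ) r, ∃ Z W : ℝ → ℂ,
        Z 0 = z ∧ HasDerivAt Z (Complex.I * z * a z) 0 ∧
        HasDerivAt W (Complex.I * σ * H z * b (H z)) 0 ∧
        HasStrictDerivAt (fun s => ‖Z s‖ ^ 2) (-2 * r ^ 2 * (a z).im) 0 ∧
        ∀ᶠ s in 𝓝 (0 : ℝ), Z s ≠ 0 ∧ W s = Z s * g (‖Z s‖ ^ 2) := by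
      intro z hz
      obtain ⟨hzR, hz0, hzr⟩ := hsph z hz
      obtain ⟨-, h2, h3, h4, -, -, h7, h8⟩ := hball z hzR
      have hZ0 : χ (Complex.exp (Complex.I * (1 : ℝ) * (0 : ℝ)) * u z) = z := by simpa using h7
      have h3' : HasStrictDerivAt
          (fun s : ℝ => χ (Complex.exp (Complex.I * (1 : ℝ) * s) * u z)) (Complex.I * z * a z) 0 := by
        simpa using h3
      refine ⟨fun s : ℝ => χ (Complex.exp (Complex.I * (1 : ℝ) * s) * u z),
        fun s : ℝ => ω (Complex.exp (Complex.I * σ * s) * v (H z)),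
        hZ0, h3'.hasDerivAt, h4.hasDerivAt, ?_, ?_⟩
      -- The derivative of `|Z|²` is `2 Re (conj z · i z a) = -2 r² Im a`.
      · have h5 := (hasStrictFDerivAt_norm_sq _).comp_hasStrictDerivAt 0 h3'
        refine h5.congr_deriv ?_
        simp only [hZ0]
        simp [Complex.inner]
        have : r ^ 2 = z.re * z.re + z.im * z.im := by
          rw [← hzr, ← Complex.normSq_eq_norm_sq, Complex.normSq_apply]
        rw [this]
        ring
      · have hZc := h3'.hasDerivAt.continuousAt
        have hm : ∀ᶠ s : ℝ in 𝓝 0,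
            χ (Complex.exp (Complex.I * (1 : ℝ) * s) * u z) ∈ Metric.ball (0 : ℂ) R :=
          hZc.eventually_mem (Metric.isOpen_ball.mem_nhds (by simpa only [hZ0] using hzR))
        filter_upwards [hm, hZc.eventually_ne (by simpa only [hZ0] using hz0)] with s hs hs0
        refine ⟨hs0, ?_⟩
        rw [← hHg _ hs, ← h2 s]
        simp
    obtain ⟨z₀, hz₀, him⟩ : ∃ z ∈ Metric.sphere (0 : ℂ) r, (a z).im ≠ 0 := by
      by_contra! hcon
      exact hanc r hr (eq_const_of_im_eq_zero_on_sphere hr (hda r hrR) hcon)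
    -- At `z₀` the flow crosses the circle transversally, so time is a differentiable function `S`
    -- of the squared modulus, and `g x = W (S x) / Z (S x)`.
    have hgd : DifferentiableAt ℝ g (r ^ 2) := by
      obtain ⟨Z, W, hZ0, hZd, hWd, hN, hev⟩ := hflowz z₀ hz₀
      obtain ⟨-, hz0, hzr⟩ := hsph z₀ hz₀
      have hN' : -2 * r ^ 2 * (a z₀).im ≠ 0 := by
        have := hr.ne'
        simp [him, this]
      set S := hN.localInverse _ _ _ hN' with hS
      have hN0 : ‖Z 0‖ ^ 2 = r ^ 2 := by rw [hZ0, hzr]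
      have hS1 := hN.to_localInverse hN'
      have hS2 := hN.eventually_right_inverse hN'
      have hS0 : S (r ^ 2) = 0 := by
        rw [← hN0]
        exact (hN.eventually_left_inverse hN').self_of_nhds
      rw [← hS] at hS1 hS2
      simp only [hN0] at hS1 hS2
      have hSc : Tendsto S (𝓝 (r ^ 2)) (𝓝 0) := by
        simpa [hS0] using hS1.hasDerivAt.continuousAt.tendsto
      have hgS : g =ᶠ[𝓝 (r ^ 2)] fun x => W (S x) / Z (S x) := by
        filter_upwards [hS2, hSc.eventually hev] with x hx1 hx2
        rw [hx2.2, hx1, mul_div_cancel_left₀ _ hx2.1]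
      refine DifferentiableAt.congr_of_eventuallyEq ?_ hgS
      refine DifferentiableAt.div ?_ ?_ ?_
      · refine DifferentiableAt.comp _ ?_ hS1.hasDerivAt.differentiableAt
        rw [hS0]; exact hWd.differentiableAt
      · refine DifferentiableAt.comp _ ?_ hS1.hasDerivAt.differentiableAt
        rw [hS0]; exact hZd.differentiableAt
      · rw [hS0, hZ0]; exact hz0
    obtain ⟨g', hg'⟩ : ∃ g', HasDerivAt g g' (r ^ 2) := ⟨_, hgd.hasDerivAt⟩
    -- Obtained by differentiating `W = Z · g(|Z|²)` at time `0` and cancelling `i z`.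
    have hrel : ∀ z ∈ Metric.sphere (0 : ℂ) r,
        a z * g (r ^ 2) + g' * r ^ 2 * (a z - (starRingEnd ℂ) (a z)) =
          σ * g (r ^ 2) * b (z * g (r ^ 2)) := by
      intro z hz
      obtain ⟨Z, W, hZ0, hZd, hWd, hN, hev⟩ := hflowz z hz
      obtain ⟨hzR, hz0, hzr⟩ := hsph z hz
      have hN0 : ‖Z 0‖ ^ 2 = r ^ 2 := by rw [hZ0, hzr]
      have h1 : HasDerivAt (fun s => g (‖Z s‖ ^ 2)) ((-2 * r ^ 2 * (a z).im) • g') 0 := by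
        refine HasDerivAt.scomp (g₁ := g) (0 : ℝ) ?_ hN.hasDerivAt
        simpa only [hN0] using hg'
      have h2 := (hZd.mul h1).congr_of_eventuallyEq (hev.mono fun s hs => hs.2)
      have h3 := hWd.unique h2
      rw [hN0, hZ0, hHg z hzR, hzr, Complex.real_smul] at h3
      have h4 := Complex.sub_conj (a z)
      rw [h4]
      have h5 : Complex.I * z ≠ 0 := mul_ne_zero Complex.I_ne_zero hz0
      apply mul_left_cancel₀ h5
      push_cast at h3 ⊢
      linear_combination -h3 + 2 * g' * r ^ 2 * z * (a z).im * Complex.I_sq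
    by_cases hg0 : g' = 0
    · rwa [hg0] at hg'
    exfalso
    have hk : g' * (r : ℂ) ^ 2 ≠ 0 := by
      have : (r : ℂ) ≠ 0 := by exact_mod_cast hr.ne'
      positivity
    -- For `g' ≠ 0` the relation can be solved for `conj a`, with `g (r²)` and `g'` fixed numbers,
    -- so the right side is holomorphic in `z`.
    refine hanc r hr (eq_const_of_conj_eq_on_sphere (B := fun z =>
      (a z * g (r ^ 2) + g' * r ^ 2 * a z - σ * g (r ^ 2) * b (z * g (r ^ 2))) / (g' * r ^ 2))
      hr (hda r hrR) ?_ ?_)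
    · refine DifferentiableOn.diffContOnCl fun z hz => ?_
      have hz' : ‖z‖ ≤ r := by
        simpa using Metric.closure_ball_subset_closedBall hz
      have haz := (hball z (by simpa using hz'.trans_lt hrR)).2.2.2.2.1.differentiableAt
      -- The argument stays where `b` is analytic because `|z g(r²)| ≤ r |g(r²)| = |H r| < R'`.
      have hbz : AnalyticAt ℂ b (z * g (r ^ 2)) := by
        refine hb _ ?_
        have hr' : (r : ℂ) ∈ Metric.ball (0 : ℂ) R := by simpa [abs_of_pos hr] using hrR
        have h1 := (hball r hr').2.2.2.2.2.1
        rw [hHg _ hr'] at h1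
        simp only [Complex.norm_real, Real.norm_eq_abs, Metric.mem_ball, dist_zero_right, norm_mul,
          abs_of_pos hr] at h1 ⊢
        exact (mul_le_mul_of_nonneg_right hz' (norm_nonneg _)).trans_lt h1
      have hbz' : DifferentiableAt ℂ (fun z => b (z * g (r ^ 2))) z :=
        DifferentiableAt.comp (g := b) z hbz.differentiableAt (differentiableAt_id.mul_const _)
      refine DifferentiableAt.differentiableWithinAt ?_
      fun_prop
    · intro z hz
      rw [eq_div_iff hk]
      linear_combination -hrel z hz
  have hgc : ∀ x ∈ Set.Ioo 0 (R ^ 2), g x = g ((R / 2) ^ 2) := by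
    have hd : ∀ x ∈ Set.Ioo 0 (R ^ 2), HasDerivAt g 0 x := by
      intro x hx
      have := hderiv (√x) (Real.sqrt_pos.2 hx.1) ((Real.sqrt_lt' hR).2 hx.2)
      rwa [Real.sq_sqrt hx.1.le] at this
    intro x hx
    refine isOpen_Ioo.is_const_of_deriv_eq_zero isPreconnected_Ioo
      (fun y hy => (hd y hy).differentiableAt.differentiableWithinAt)
      (fun y hy => (hd y hy).deriv) hx ⟨by positivity, ?_⟩
    nlinarith
  refine ⟨g ((R / 2) ^ 2), ?_⟩
  filter_upwards [Metric.ball_mem_nhds _ hR] with z hz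
  rw [hHg z hz]
  rcases eq_or_ne z 0 with rfl | hz0
  · simp
  rw [hgc, mul_comm]
  have h1 : ‖z‖ < R := by simpa using hz
  have h2 : 0 < ‖z‖ := norm_pos_iff.2 hz0
  exact ⟨by positivity, by gcongr⟩

/-! ### Linearization of a circle action at a fixed point -/

/-- A function with invertible derivative is injective near the point. -/
theorem AnalyticAt.exists_injOn {f : ℂ → ℂ} {p : ℂ} (hf : AnalyticAt ℂ f p) (hf' : deriv f p ≠ 0) :
    ∃ V ∈ 𝓝 p, Set.InjOn f V := by
  refine ⟨_, hf.hasStrictDerivAt.eventually_left_inverse hf', fun x hx y hy hxy => ?_⟩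
  have hx' := Set.mem_ofPred_eq ▸ hx
  have hy' := Set.mem_ofPred_eq ▸ hy
  rw [← hx', ← hy', hxy]

namespace HolCircleAction

variable (γ : HolCircleAction)

theorem continuousAt_uncurry {t : UnitAddCircle} {z : ℂ} (hz : z ∈ γ.domain) :
    ContinuousAt (fun q : UnitAddCircle × ℂ => γ.act q.1 q.2) (t, z) :=
  γ.continuousOn.continuousAt (prod_mem_nhds univ_mem (γ.isOpen_domain.mem_nhds hz))

theorem continuous_act {z : ℂ} (hz : z ∈ γ.domain) : Continuous fun t => γ.act t z :=
  continuous_iff_continuousAt.2 fun t =>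
    (γ.continuousAt_uncurry (t := t) hz).comp (f := fun t => (t, z))
      (Continuous.prodMk continuous_id continuous_const).continuousAt

/-- Orbits of points close to a fixed point stay close to it. -/
theorem eventually_forall_act_mem {p : ℂ} (hp : p ∈ γ.domain) (hfix : ∀ t, γ.act t p = p)
    {V : Set ℂ} (hV : V ∈ 𝓝 p) : ∀ᶠ z in 𝓝 p, ∀ t, γ.act t z ∈ V := by
  have := (isCompact_univ (X := UnitAddCircle)).eventually_forall_of_forall_eventually
    (x₀ := p) (P := fun z t => γ.act t z ∈ V) fun t _ => by
      have h1 := (γ.continuousAt_uncurry (t := t) hp).comp_of_eq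
        (f := fun q : ℂ × UnitAddCircle => q.swap) (x := (p, t)) continuous_swap.continuousAt rfl
      have h2 : Tendsto (fun q : ℂ × UnitAddCircle => γ.act q.2 q.1) (𝓝 (p, t)) (𝓝 p) := by
        have := h1.tendsto
        simpa only [Function.comp_def, Prod.fst_swap, Prod.snd_swap, hfix] using this
      exact h2 hV
  exact this.mono fun z hz t => hz t (Set.mem_univ t)

/-- Cauchy's estimate on a small circle around `z`, on which `γ^t → γ^{t₀}` uniformly by
compactness. It makes the Fourier coefficients of the derivative available. -/
theorem continuous_deriv_act {z : ℂ} (hz : z ∈ γ.domain) :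
    Continuous fun t => deriv (γ.act t) z := by
  obtain ⟨r, hr, hball⟩ := Metric.nhds_basis_closedBall.mem_iff.1 (γ.isOpen_domain.mem_nhds hz)
  have hd : ∀ t, DiffContOnCl ℂ (γ.act t) (Metric.ball z r) := fun t =>
    ((γ.holomorphic t).mono hball).diffContOnCl_ball subset_rfl
  refine continuous_iff_continuousAt.2 fun t₀ => Metric.tendsto_nhds.2 fun ε hε => ?_
  have h1 := (isCompact_sphere z r).eventually_forall_of_forall_eventually
    (x₀ := t₀) (P := fun t w => ‖γ.act t w - γ.act t₀ w‖ < ε / 2 * r) fun w hw => by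
      have hw' := hball (Metric.sphere_subset_closedBall hw)
      have h2 := γ.continuousAt_uncurry (t := t₀) hw'
      have h3 : ContinuousAt (fun q : UnitAddCircle × ℂ => γ.act t₀ q.2) (t₀, w) :=
        h2.comp_of_eq (f := fun q : UnitAddCircle × ℂ => (t₀, q.2)) (x := (t₀, w))
          (by fun_prop) rfl
      have h4 := (h2.sub h3).norm
      refine h4.eventually_lt continuousAt_const ?_
      have : ‖γ.act t₀ w - γ.act t₀ w‖ < ε / 2 * r := by
        rw [sub_self, norm_zero]
        positivity
      exact this
  filter_upwards [h1] with t ht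
  have h5 := Complex.norm_deriv_le_of_forall_mem_sphere_norm_le hr ((hd t).sub (hd t₀))
    fun w hw => (ht w hw).le
  have h6 : ∀ t, DifferentiableAt ℂ (γ.act t) z := fun t =>
    (γ.holomorphic t).differentiableAt (γ.isOpen_domain.mem_nhds hz)
  rw [deriv_sub (h6 t) (h6 t₀), mul_div_cancel_right₀ _ hr.ne'] at h5
  rw [dist_eq_norm]
  linarith

/-- `φ` is a holomorphic coordinate, centred at the fixed point `p`, in which the action consists
of the rotations `z ↦ e^{2πiεt} z`. -/
structure Linearizes (p : ℂ) (φ : ℂ → ℂ) (ε : ℝ) : Prop where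
  analyticAt : AnalyticAt ℂ φ p
  map_eq_zero : φ p = 0
  deriv_ne_zero : deriv φ p ≠ 0
  sign : ε = 1 ∨ ε = -1
  equivariant : ∀ᶠ z in 𝓝 p, ∀ t : ℝ,
    φ (γ.act t z) = Complex.exp (Complex.I * (2 * Real.pi * ε * t : ℝ)) * φ z

/-- Each Fourier coefficient `φ k` of the orbit map intertwines the action with the character `k`.
Some `φ k` has nonzero derivative at `p`, hence is a coordinate, and faithfulness forces `k = ±1`.
-/
theorem exists_linearizes {p : ℂ} (hp : p ∈ γ.domain) (hfix : ∀ t, γ.act t p = p) :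
    ∃ φ ε, γ.Linearizes p φ ε := by
  set φ : ℤ → ℂ → ℂ := fun k z => fourierCoeff (fun t => γ.act t z - p) k with hφ
  have hdist : ∀ᶠ z in 𝓝 p, z ∈ γ.domain ∧ ∀ t, γ.act t z ∈ Metric.ball p 1 :=
    (γ.isOpen_domain.eventually_mem hp).and
      (γ.eventually_forall_act_mem hp hfix (Metric.ball_mem_nhds _ one_pos))
  obtain ⟨δ, hδ, hball⟩ := Metric.nhds_basis_closedBall.eventually_iff.1 hdist
  have hderiv : ∀ k, ∀ x ∈ Metric.ball p (δ / 2),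
      HasDerivAt (φ k) (fourierCoeff (fun t => deriv (γ.act t) x) k) x := by
    intro k x hx
    have hsub : ∀ z ∈ Metric.ball p (δ / 2), Metric.closedBall z (δ / 2) ⊆ Metric.closedBall p δ := by
      intro z hz w hw
      simp only [Metric.mem_ball, Metric.mem_closedBall] at *
      linarith [dist_triangle w z p]
    have hself : ∀ z ∈ Metric.ball p (δ / 2), z ∈ γ.domain := fun z hz =>
      (hball (hsub z hz (Metric.mem_closedBall_self (by positivity)))).1
    have hcont : ∀ z ∈ γ.domain,
        Continuous fun t : UnitAddCircle => fourier (-k) t • (γ.act t z - p) := fun z hz =>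
      (fourier (-k)).continuous.smul ((γ.continuous_act hz).sub continuous_const)
    refine (hasDerivAt_integral_of_dominated_loc_of_deriv_le (bound := fun _ => 1 / (δ / 2))
      (F := fun z (t : UnitAddCircle) => fourier (-k) t • (γ.act t z - p))
      (F' := fun z (t : UnitAddCircle) => fourier (-k) t • deriv (γ.act t) z)
      (Metric.isOpen_ball.mem_nhds hx) ?_ ?_ ?_ ?_ ?_ ?_).2
    · filter_upwards [γ.isOpen_domain.mem_nhds (hself x hx)] with z hz
      exact (hcont z hz).aestronglyMeasurable
    · exact (hcont x (hself x hx)).integrable_of_hasCompactSupport (HasCompactSupport.of_compactSpace _)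
    · exact ((fourier (-k)).continuous.smul
        (γ.continuous_deriv_act (hself x hx))).aestronglyMeasurable
    · refine Eventually.of_forall fun t z hz => ?_
      have h1 : DiffContOnCl ℂ (γ.act t) (Metric.ball z (δ / 2)) :=
        ((γ.holomorphic t).mono fun w hw => (hball (hsub z hz hw)).1).diffContOnCl_ball subset_rfl
      have h2 := Complex.norm_deriv_le_of_forall_mem_sphere_norm_le (half_pos hδ) (h1.sub_const p)
        (C := 1) fun w hw => by
          have := (hball (hsub z hz (Metric.sphere_subset_closedBall hw))).2 t
          rw [mem_ball_iff_norm] at this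
          exact this.le
      rw [deriv_sub_const] at h2
      rwa [norm_smul, fourier_apply, Circle.norm_coe, one_mul]
    · exact MeasureTheory.integrable_const _
    · refine Eventually.of_forall fun t z hz => ?_
      exact (((γ.holomorphic t).differentiableAt (γ.isOpen_domain.mem_nhds (hself z hz))).hasDerivAt
        |>.sub_const p).const_smul (fourier (-k) t)
  -- Translation invariance of Haar measure: substitute `t + s` for `t`.
  have hequiv : ∀ k, ∀ z ∈ γ.domain, ∀ s, φ k (γ.act s z) = fourier k s * φ k z := by
    intro k z hz s
    simp only [hφ, fourierCoeff]
    rw [← MeasureTheory.integral_const_mul,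
      ← MeasureTheory.integral_add_right_eq_self (fun t => fourier k s * _) s]
    congr 1 with t
    rw [γ.act_add t s z hz]
    have : (fourier (-k) t : ℂ) = fourier k s * fourier (-k) (t + s) := by
      simp only [fourier_apply, smul_add, AddCircle.toCircle_add, Circle.coe_mul]
      have h1 : ((k • s).toCircle : ℂ) * ((-k) • s).toCircle = 1 := by
        rw [← Circle.coe_mul, ← AddCircle.toCircle_add, neg_smul, add_neg_cancel,
          AddCircle.toCircle_zero, Circle.coe_one]
      linear_combination -((((-k) • t).toCircle : Circle) : ℂ) * h1
    rw [this, smul_eq_mul, smul_eq_mul, mul_assoc]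
  have hp' : p ∈ Metric.ball p (δ / 2) := Metric.mem_ball_self (half_pos hδ)
  obtain ⟨k, hk⟩ : ∃ k, deriv (φ k) p ≠ 0 := by
    -- Otherwise all Fourier coefficients of the continuous function `t ↦ (γ^t)'(p)` vanish, so it
    -- is zero; yet its value at `t = 0` is `1`.
    by_contra! hcon
    set m : C(UnitAddCircle, ℂ) := ⟨fun t => deriv (γ.act t) p, γ.continuous_deriv_act hp⟩
    have h1 : ∀ k, fourierCoeff m k = 0 := fun k => by
      rw [← hcon k, (hderiv k p hp').deriv]; rfl
    have h2 := has_pointwise_sum_fourier_series_of_summable (f := m)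
      (summable_zero.congr fun k => (h1 k).symm) 0
    simp only [h1, zero_smul] at h2
    have h3 : m 0 = 0 := h2.unique hasSum_zero
    have h4 : m 0 = 1 := by
      refine ((hasDerivAt_id p).congr_of_eventuallyEq ?_).deriv
      filter_upwards [γ.isOpen_domain.mem_nhds hp] with z hz
      exact γ.act_zero z hz
    exact one_ne_zero (h4.symm.trans h3)
  have han : AnalyticAt ℂ (φ k) p :=
    DifferentiableOn.analyticAt (s := Metric.ball p (δ / 2))
      (fun x hx => (hderiv k x hx).differentiableAt.differentiableWithinAt)
      (Metric.isOpen_ball.mem_nhds hp')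
  obtain ⟨V, hV, hinj⟩ := han.exists_injOn hk
  -- An element of the kernel of the character fixes every point near `p`, hence every point of the
  -- connected domain by the identity theorem.
  have hfaith : ∀ s : UnitAddCircle, fourier k s = 1 → s = 0 := by
    intro s hs
    refine γ.faithful s fun z hz => ?_
    have h1 : γ.act s =ᶠ[𝓝 p] id := by
      filter_upwards [γ.eventually_forall_act_mem hp hfix hV, hV, γ.isOpen_domain.mem_nhds hp]
        with w hw1 hw2 hw3
      refine hinj (hw1 s) hw2 ?_
      rw [hequiv k w hw3 s, hs, one_mul, id]
    exact ((γ.holomorphic s).analyticOnNhd γ.isOpen_domain).eqOn_of_preconnected_of_eventuallyEq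
      analyticOnNhd_id γ.isConnected_domain.isPreconnected hp h1 hz
  -- If `k = 0`, the kernel contains `1/2`; otherwise it contains `1/k`, which must therefore be an
  -- integer.
  have hk1 : (k : ℝ) = 1 ∨ (k : ℝ) = -1 := by
    have hhalf : ((2⁻¹ : ℝ) : UnitAddCircle) ≠ 0 := by
      rw [Ne, AddCircle.coe_eq_zero_iff]
      rintro ⟨n, hn⟩
      have h2 : (2 * n : ℝ) = 1 := by simp at hn; linarith
      have h3 : 2 * n = 1 := by exact_mod_cast h2
      omega
    have hk0 : k ≠ 0 := fun h => hhalf (hfaith _ (by rw [h, fourier_zero]))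
    have hkR : (k : ℝ) ≠ 0 := by exact_mod_cast hk0
    have hone : fourier k (((k : ℝ)⁻¹ : ℝ) : UnitAddCircle) = 1 := by
      rw [fourier_coe_apply]
      have : (2 * Real.pi * Complex.I * k * ((k : ℝ)⁻¹ : ℝ) / (1 : ℝ) : ℂ) =
          2 * Real.pi * Complex.I := by
        have : (k : ℂ) ≠ 0 := by exact_mod_cast hk0
        push_cast
        field_simp
      rw [this, Complex.exp_two_pi_mul_I]
    obtain ⟨n, hn⟩ := (AddCircle.coe_eq_zero_iff _).1 (hfaith _ hone)
    have h1 : (n : ℝ) * k = 1 := by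
      simp at hn
      rw [hn, inv_mul_cancel₀ hkR]
    have h2 : n * k = 1 := by exact_mod_cast h1
    rcases Int.isUnit_iff.1 (IsUnit.of_mul_eq_one_right _ h2) with h | h <;> simp [h]
  refine ⟨φ k, k, han, ?_, hk, hk1, ?_⟩
  · simp [hφ, fourierCoeff, hfix]
  · filter_upwards [γ.isOpen_domain.mem_nhds hp] with z hz t
    rw [hequiv k z hz, fourier_coe_apply]
    congr 2
    push_cast
    ring

end HolCircleAction

/-! ### Equivariant maps in linearizing coordinates -/

theorem AnalyticAt.exists_localInverse {f : ℂ → ℂ} {p : ℂ} (hf : AnalyticAt ℂ f p) (hf0 : f p = 0)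
    (hf' : deriv f p ≠ 0) : ∃ g : ℂ → ℂ, AnalyticAt ℂ g 0 ∧ g 0 = p ∧ deriv g 0 ≠ 0 ∧
      (∀ᶠ z in 𝓝 p, g (f z) = z) ∧ ∀ᶠ w in 𝓝 (0 : ℂ), f (g w) = w := by
  have hl := hf.hasStrictDerivAt.eventually_left_inverse hf'
  have hr := hf.hasStrictDerivAt.eventually_right_inverse hf'
  have hd := (hf.hasStrictDerivAt.to_localInverse hf').hasDerivAt.deriv
  have ha := hf.analyticAt_localInverse hf'
  have h0 := hl.self_of_nhds
  rw [hf0] at hr hd ha h0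
  exact ⟨_, ha, h0, by rw [hd]; exact inv_ne_zero hf', hl, hr⟩

theorem deriv_comp_ne_zero {f g : ℂ → ℂ} {x y : ℂ} (hg : AnalyticAt ℂ g x) (hf : AnalyticAt ℂ f y)
    (hxy : g x = y) (hg' : deriv g x ≠ 0) (hf' : deriv f y ≠ 0) : deriv (f ∘ g) x ≠ 0 := by
  subst hxy
  rw [deriv_comp x hf.differentiableAt hg.differentiableAt]
  exact mul_ne_zero hf' hg'

/-- Supplies the target coordinates when `h` is replaced by its conjugate in the
orientation-reversing case. -/
theorem AnalyticAt.conj_comp_conj {f : ℂ → ℂ} {p : ℂ} (hf : AnalyticAt ℂ f p) :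
    AnalyticAt ℂ (starRingEnd ℂ ∘ f ∘ starRingEnd ℂ) (starRingEnd ℂ p) := by
  rw [Complex.analyticAt_iff_eventually_differentiableAt] at hf ⊢
  have : Tendsto (starRingEnd ℂ) (𝓝 (starRingEnd ℂ p)) (𝓝 p) := by
    simpa using (Complex.continuous_conj.tendsto (starRingEnd ℂ p))
  filter_upwards [this.eventually hf] with z hz
  exact differentiableAt_conj_conj_iff.2 hz

namespace HolCircleAction

variable {γ ρ : HolCircleAction} {φ ψ : ℂ → ℂ} {ε₁ ε₂ : ℝ}

theorem Linearizes.sq_eq_one {p : ℂ} (hφ : γ.Linearizes p φ ε₁) : ε₁ * ε₁ = 1 := by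
  rcases hφ.sign with h | h <;> simp [h]

/-- Two actions with proportional linearizing coordinates form a trivial pair. -/
theorem Linearizes.trivialPair (hφ : γ.Linearizes 0 φ ε₁) (hψ : ρ.Linearizes 0 ψ ε₂) {c : ℂ}
    (hc : ∀ᶠ z in 𝓝 (0 : ℂ), ψ z = c * φ z) : TrivialPair γ ρ := by
  obtain ⟨V, hV, hinj⟩ := hψ.analyticAt.exists_injOn hψ.deriv_ne_zero
  have hε := hψ.sq_eq_one
  have hε' := hφ.sq_eq_one
  -- Proportional coordinates have the same rotations; the signs `ε₁`, `ε₂` only affect the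
  -- direction of time.
  have hγρ : ∀ᶠ z in 𝓝 (0 : ℂ), ∀ t : ℝ,
      γ.act t z = ρ.act ((ε₁ * ε₂ * t : ℝ) : UnitAddCircle) z := by
    filter_upwards [hc, γ.eventually_forall_act_mem γ.zero_mem γ.fixes_zero hc, hφ.equivariant,
      hψ.equivariant, γ.eventually_forall_act_mem γ.zero_mem γ.fixes_zero hV,
      ρ.eventually_forall_act_mem ρ.zero_mem ρ.fixes_zero hV] with z h1 h2 h3 h4 h5 h6 t
    refine hinj (h5 _) (h6 _) ?_
    have h7 := h2 t
    rw [h7, h3, h4, h1]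
    have : 2 * Real.pi * ε₂ * (ε₁ * ε₂ * t) = 2 * Real.pi * ε₁ * t := by
      linear_combination 2 * Real.pi * ε₁ * t * hε
    rw [this]
    ring
  filter_upwards [hγρ] with z hz
  ext w
  constructor
  · rintro ⟨t, rfl⟩
    obtain ⟨t, rfl⟩ := QuotientAddGroup.mk_surjective t
    exact ⟨_, (hz t).symm⟩
  · rintro ⟨t, rfl⟩
    obtain ⟨t, rfl⟩ := QuotientAddGroup.mk_surjective t
    refine ⟨((ε₁ * ε₂ * t : ℝ) : UnitAddCircle), (hz _).trans ?_⟩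
    have : ε₁ * ε₂ * (ε₁ * ε₂ * t) = t := by
      linear_combination ε₂ * ε₂ * t * hε' + t * hε
    rw [this]

/-- A continuous map that sends the orbits of two actions to rotations in two coordinates `φ'` and
`ψ'` is linear with respect to the linearizing coordinate of the first action and `φ'`. -/
theorem Linearizes.exists_eq_mul (hφ : γ.Linearizes 0 φ ε₁) (hψ : ρ.Linearizes 0 ψ ε₂)
    (hγρ : NontrivialPair γ ρ) {k φ' ψ' : ℂ → ℂ} {σ : ℝ} (hk : ContinuousAt k 0)
    (hφ' : AnalyticAt ℂ φ' (k 0)) (hφ'0 : φ' (k 0) = 0) (hφ'd : deriv φ' (k 0) ≠ 0)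
    (hψ' : AnalyticAt ℂ ψ' (k 0)) (hψ'0 : ψ' (k 0) = 0) (hψ'd : deriv ψ' (k 0) ≠ 0)
    (hkγ : ∀ᶠ z in 𝓝 (0 : ℂ), ∀ t : ℝ,
      φ' (k (γ.act t z)) = Complex.exp (Complex.I * (2 * Real.pi * ε₁ * t : ℝ)) * φ' (k z))
    (hkρ : ∀ᶠ z in 𝓝 (0 : ℂ), ∀ t : ℝ,
      ψ' (k (ρ.act t z)) = Complex.exp (Complex.I * (2 * Real.pi * σ * t : ℝ)) * ψ' (k z)) :
    ∃ c : ℂ, ∀ᶠ z in 𝓝 (0 : ℂ), φ' (k z) = c * φ z := by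
  obtain ⟨χ, hχ, hχ0, hχd, hχφ, hφχ⟩ :=
    hφ.analyticAt.exists_localInverse hφ.map_eq_zero hφ.deriv_ne_zero
  obtain ⟨ξ, hξ, hξ0, -, hξψ, -⟩ :=
    hψ.analyticAt.exists_localInverse hψ.map_eq_zero hψ.deriv_ne_zero
  obtain ⟨χ', hχ', hχ'0, hχ'd, hχφ', hφχ'⟩ := hφ'.exists_localInverse hφ'0 hφ'd
  obtain ⟨ξ', hξ', hξ'0, -, hξψ', -⟩ := hψ'.exists_localInverse hψ'0 hψ'd
  have hχt : Tendsto χ (𝓝 0) (𝓝 0) := by simpa [hχ0] using hχ.continuousAt.tendsto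
  have hφt : Tendsto φ (𝓝 0) (𝓝 0) := by
    simpa [hφ.map_eq_zero] using hφ.analyticAt.continuousAt.tendsto
  have hχ't : Tendsto χ' (𝓝 0) (𝓝 (k 0)) := by simpa [hχ'0] using hχ'.continuousAt.tendsto
  have transfer : ∀ {P : ℂ → Prop}, (∀ᶠ z in 𝓝 (0 : ℂ), P (φ z)) → ∀ᶠ w in 𝓝 (0 : ℂ), P w := by
    intro P hP
    filter_upwards [hχt.eventually hP, hφχ] with w h1 h2
    rwa [h2] at h1
  have hε₁ := hφ.sq_eq_one
  have hε₂ := hψ.sq_eq_one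
  have hpi := Real.pi_ne_zero
  have hγmem := fun {V : Set ℂ} (hV : V ∈ 𝓝 (0 : ℂ)) =>
    γ.eventually_forall_act_mem γ.zero_mem γ.fixes_zero hV
  have hρmem := fun {V : Set ℂ} (hV : V ∈ 𝓝 (0 : ℂ)) =>
    ρ.eventually_forall_act_mem ρ.zero_mem ρ.fixes_zero hV
  -- `H` is `k` read in the coordinates `φ` and `φ'`, while `u` and `v` are the coordinates of the
  -- second actions read in those of the first. The angle `s` corresponds to the time `ε₂ s / 2π` of
  -- `ρ`, whence the speed `σ ε₂`.
  obtain ⟨c, hc⟩ := eventually_eq_mul_of_equivariant (H := φ' ∘ k ∘ χ) (u := ψ ∘ χ) (v := ψ' ∘ χ')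
    (χ := φ ∘ ξ) (ω := φ' ∘ ξ') (σ := σ * ε₂)
    (by
      refine ContinuousAt.comp (g := φ') ?_ (ContinuousAt.comp (g := k) ?_ hχ.continuousAt)
      · simpa [hχ0] using hφ'.continuousAt
      · simpa [hχ0] using hk)
    (by
      refine transfer ?_
      filter_upwards [hχφ, hγmem hχφ, hφ.equivariant, hkγ] with z h1 h2 h3 h4 x
      have hx : 2 * Real.pi * ε₁ * (ε₁ * x / (2 * Real.pi)) = x := by
        field_simp
        linear_combination x * hε₁
      have h3' := h3 (ε₁ * x / (2 * Real.pi))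
      have h4' := h4 (ε₁ * x / (2 * Real.pi))
      have h2' := h2 ((ε₁ * x / (2 * Real.pi) : ℝ) : UnitAddCircle)
      rw [hx] at h3' h4'
      simp only [Function.comp_apply]
      rw [← h3', h2', h4', h1])
    (AnalyticAt.comp_of_eq hψ.analyticAt hχ hχ0)
    (by simp [hχ0, hψ.map_eq_zero])
    (deriv_comp_ne_zero hχ hψ.analyticAt hχ0 hχd hψ.deriv_ne_zero)
    (AnalyticAt.comp_of_eq hφ.analyticAt hξ hξ0)
    (by
      refine transfer ?_
      filter_upwards [hχφ, hξψ] with z h1 h2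
      simp only [Function.comp_apply]
      rw [h1, h2])
    (AnalyticAt.comp_of_eq hψ' hχ' hχ'0)
    (by simp [hχ'0, hψ'0])
    (deriv_comp_ne_zero hχ' hψ' hχ'0 hχ'd hψ'd)
    (AnalyticAt.comp_of_eq hφ' hξ' hξ'0)
    (by
      filter_upwards [hχ't.eventually hξψ', hφχ'] with w h1 h2
      simp only [Function.comp_apply]
      rw [h1, h2])
    (by
      refine transfer ?_
      have hkt := hk.tendsto
      filter_upwards [hχφ, hρmem hξψ, hρmem hχφ, hψ.equivariant, hkρ, hkt.eventually hχφ',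
        hρmem (hkt.eventually hξψ')] with z h1 h2 h3 h4 h5 h6 h7 s
      have hx : 2 * Real.pi * ε₂ * (ε₂ * s / (2 * Real.pi)) = s := by
        field_simp
        linear_combination s * hε₂
      have hx' : 2 * Real.pi * σ * (ε₂ * s / (2 * Real.pi)) = σ * ε₂ * s := by
        field_simp
      set t := ε₂ * s / (2 * Real.pi)
      have h2' := h2 t
      have h3' := h3 t
      have h4' := h4 t
      have h5' := h5 t
      have h7' := h7 t
      rw [hx] at h4'
      rw [hx', Complex.ofReal_mul, ← mul_assoc] at h5'
      simp only [Function.comp_apply]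
      rw [h1, ← h4', h2', h3', h6, ← h5', h7'])
    -- If `u` were linear, `ψ` would be proportional to `φ` and the pair trivial.
    (by
      rintro ⟨c, hc⟩
      refine hγρ (hφ.trivialPair hψ (c := c) ?_)
      filter_upwards [hχφ, hφt.eventually hc] with z h1 h2
      rwa [Function.comp_apply, h1] at h2)
  refine ⟨c, ?_⟩
  filter_upwards [hχφ, hφt.eventually hc] with z h1 h2
  rwa [Function.comp_apply, Function.comp_apply, h1] at h2

/-- Merges both kinds of equivariance through a sign `τ`. Since `h 0` need not be `0`, it also
records that `h 0` is a fixed point, so that `γ'` can be linearized there. -/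
theorem Equivariant.exists_sign {γ γ' : HolCircleAction} {h : ℂ → ℂ} (hγ : Equivariant γ γ' h) :
    h 0 ∈ γ'.domain ∧ (∀ t, γ'.act t (h 0) = h 0) ∧ ∃ τ : ℝ, (τ = 1 ∨ τ = -1) ∧
      ∀ᶠ z in 𝓝 (0 : ℂ), ∀ t : ℝ, h (γ.act t z) = γ'.act ((τ * t : ℝ) : UnitAddCircle) (h z) := by
  rcases hγ with hγ | hγ
  · refine ⟨hγ.self_of_nhds.1, fun t => ?_, 1, Or.inl rfl, hγ.mono fun z hz t => ?_⟩
    · rw [← hγ.self_of_nhds.2 t, γ.fixes_zero]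
    · rw [hz.2 t, one_mul]
  · refine ⟨hγ.self_of_nhds.1, fun t => ?_, -1, Or.inr rfl, hγ.mono fun z hz t => ?_⟩
    · have := hγ.self_of_nhds.2 (-t)
      rwa [neg_neg, γ.fixes_zero, eq_comm] at this
    · rw [hz.2 t, neg_one_mul, AddCircle.coe_neg]

theorem Linearizes.comp_equivariant {γ γ' : HolCircleAction} {h φ' : ℂ → ℂ} {ε' τ : ℝ}
    (hφ' : γ'.Linearizes (h 0) φ' ε') (hh : ContinuousAt h 0)
    (hτ : ∀ᶠ z in 𝓝 (0 : ℂ), ∀ t : ℝ,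
      h (γ.act t z) = γ'.act ((τ * t : ℝ) : UnitAddCircle) (h z)) :
    ∀ᶠ z in 𝓝 (0 : ℂ), ∀ t : ℝ, φ' (h (γ.act t z)) =
      Complex.exp (Complex.I * (2 * Real.pi * (ε' * τ) * t : ℝ)) * φ' (h z) := by
  filter_upwards [hτ, hh.tendsto.eventually hφ'.equivariant] with z h1 h2 t
  rw [h1, h2, ← mul_assoc, ← mul_assoc]

/-- A local homeomorphism that is equivariant with respect to two pairs of actions is linear or
antilinear in linearizing coordinates of the first actions. -/
theorem eq_mul_or_conj_eq_mul {γ ρ γ' ρ' : HolCircleAction} (hγρ : NontrivialPair γ ρ)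
    (h : OpenPartialHomeomorph ℂ ℂ) (h0 : (0 : ℂ) ∈ h.source) (hγ : Equivariant γ γ' h)
    (hρ : Equivariant ρ ρ' h) {φ φ' : ℂ → ℂ} {ε ε' : ℝ} (hφ : γ.Linearizes 0 φ ε)
    (hφ' : γ'.Linearizes (h 0) φ' ε') :
    (∃ c : ℂ, c ≠ 0 ∧ ∀ᶠ z in 𝓝 (0 : ℂ), φ' (h z) = c * φ z) ∨
      ∃ c : ℂ, c ≠ 0 ∧ ∀ᶠ z in 𝓝 (0 : ℂ), starRingEnd ℂ (φ' (h z)) = c * φ z := by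
  have hh : ContinuousAt h 0 := h.continuousAt h0
  have hne : ¬ ∀ᶠ z in 𝓝 (0 : ℂ), φ' (h z) = 0 := by
    intro hcon
    obtain ⟨V, hV, hinj⟩ := hφ'.analyticAt.exists_injOn hφ'.deriv_ne_zero
    have h1 : ∀ᶠ z in 𝓝 (0 : ℂ), z = 0 := by
      filter_upwards [hcon, hh.tendsto hV, h.open_source.mem_nhds h0] with z h1 h2 h3
      refine h.injOn h3 h0 (hinj h2 (mem_of_mem_nhds hV) ?_)
      rw [h1, hφ'.map_eq_zero]
    have h2 : ∀ᶠ z in 𝓝[≠] (0 : ℂ), z = 0 := h1.filter_mono nhdsWithin_le_nhds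
    obtain ⟨z, hz1, hz2⟩ := (h2.and eventually_mem_nhdsWithin).exists
    exact hz2 hz1
  obtain ⟨ψ, ε₂, hψ⟩ := ρ.exists_linearizes ρ.zero_mem ρ.fixes_zero
  obtain ⟨-, -, τ, hτ, hτγ⟩ := hγ.exists_sign
  obtain ⟨hd, hfix, τ', -, hτρ⟩ := hρ.exists_sign
  obtain ⟨ψ', ε₂', hψ'⟩ := ρ'.exists_linearizes hd hfix
  have e1 := hφ'.comp_equivariant hh hτγ
  have e2 := hψ'.comp_equivariant hh hτρ
  -- Equal signs lead to the linear case; opposite signs are made equal by conjugating `h`, which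
  -- reverses the rotation in the target.
  have hs : ε' * τ = ε ∨ ε' * τ = -ε := by
    rcases hφ.sign with h1 | h1 <;> rcases hφ'.sign with h2 | h2 <;> rcases hτ with h3 | h3 <;>
      simp [h1, h2, h3]
  rcases hs with hs | hs
  · rw [hs] at e1
    obtain ⟨c, hc⟩ := hφ.exists_eq_mul hψ hγρ hh hφ'.analyticAt hφ'.map_eq_zero
      hφ'.deriv_ne_zero hψ'.analyticAt hψ'.map_eq_zero hψ'.deriv_ne_zero e1 e2
    refine Or.inl ⟨c, ?_, hc⟩
    rintro rfl
    exact hne (hc.mono fun z hz => by rw [hz, zero_mul])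
  · rw [hs] at e1
    have hconj : ∀ x : ℝ, starRingEnd ℂ (Complex.exp (Complex.I * x)) =
        Complex.exp (Complex.I * (-x : ℝ)) := by
      intro x
      rw [← Complex.exp_conj, map_mul, Complex.conj_I, Complex.conj_ofReal]
      simp
    obtain ⟨c, hc⟩ := hφ.exists_eq_mul hψ hγρ (k := starRingEnd ℂ ∘ h) (σ := -(ε₂' * τ'))
      (φ' := starRingEnd ℂ ∘ φ' ∘ starRingEnd ℂ) (ψ' := starRingEnd ℂ ∘ ψ' ∘ starRingEnd ℂ)
      (Complex.continuous_conj.continuousAt.comp hh) hφ'.analyticAt.conj_comp_conj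
      (by simp [hφ'.map_eq_zero])
      (by rw [deriv_conj_conj]; simpa using hφ'.deriv_ne_zero) hψ'.analyticAt.conj_comp_conj
      (by simp [hψ'.map_eq_zero])
      (by rw [deriv_conj_conj]; simpa using hψ'.deriv_ne_zero)
      (e1.mono fun z hz t => by
        simp only [Function.comp_apply, Complex.conj_conj]
        rw [hz t, map_mul, hconj]
        congr 4
        ring)
      (e2.mono fun z hz t => by
        simp only [Function.comp_apply, Complex.conj_conj]
        rw [hz t, map_mul, hconj]
        congr 4
        ring)
    simp only [Function.comp_apply, Complex.conj_conj] at hc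
    refine Or.inr ⟨c, ?_, hc⟩
    rintro rfl
    exact hne (hc.mono fun z hz => by simpa using hz)

end HolCircleAction

/-! ### Regularity and orientation -/

/-- A continuous map that is a holomorphic map in a holomorphic coordinate is holomorphic. -/
theorem analyticAt_of_comp_eq {k F φ : ℂ → ℂ} {c : ℂ} (hk : ContinuousAt k 0)
    (hF : AnalyticAt ℂ F (k 0)) (hF0 : F (k 0) = 0) (hF' : deriv F (k 0) ≠ 0)
    (hφ : AnalyticAt ℂ φ 0) (hφ0 : φ 0 = 0) (hφ' : deriv φ 0 ≠ 0) (hc : c ≠ 0)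
    (h : ∀ᶠ z in 𝓝 (0 : ℂ), F (k z) = c * φ z) : AnalyticAt ℂ k 0 ∧ deriv k 0 ≠ 0 := by
  obtain ⟨χ, hχ, -, hχd, hχF, -⟩ := hF.exists_localInverse hF0 hF'
  have hg : AnalyticAt ℂ (fun z => c * φ z) 0 := analyticAt_const.mul hφ
  have hg0 : (fun z => c * φ z) 0 = 0 := by simp [hφ0]
  have hgd : deriv (fun z => c * φ z) 0 ≠ 0 := by
    rw [deriv_const_mul _ hφ.differentiableAt]
    exact mul_ne_zero hc hφ'
  have heq : χ ∘ (fun z => c * φ z) =ᶠ[𝓝 0] k := by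
    filter_upwards [h, hk.tendsto.eventually hχF] with z h1 h2
    rw [Function.comp_apply, ← h1, h2]
  refine ⟨(AnalyticAt.comp_of_eq hχ hg hg0).congr heq, ?_⟩
  rw [← heq.deriv_eq]
  exact deriv_comp_ne_zero hg hχ hg0 hgd hχd

/-- The conjugate of a conformal map does not preserve orientation. -/
theorem not_orientationPreservingAtZero {h : ℂ → ℂ} {b : ℂ}
    (hb : HasDerivAt (fun z => starRingEnd ℂ (h z)) b 0) (hb0 : b ≠ 0) :
    ¬ OrientationPreservingAtZero h := by
  intro hor
  have hbn : 0 < ‖b‖ := norm_pos_iff.2 hb0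
  obtain ⟨δ, hδ, hball⟩ := Metric.eventually_nhds_iff_ball.1
    (hb.isLittleO.def (half_pos hbn))
  obtain ⟨r, ⟨θ, hθc, hθ, hθ1⟩, hr, hrδ⟩ := (hor.and (Ioo_mem_nhdsGT hδ)).exists
  -- `F` is the angle from `conj (h z - h 0)` to its linear approximation `b z`. It grows by `4π`
  -- around the circle, so at some point the two are opposite, and their distance `N + r ‖b‖`
  -- exceeds the allowed error `r ‖b‖ / 2`.
  set F : ℝ → ℝ := fun t => 2 * Real.pi * (θ t + t) + b.arg with hF
  have hFc : ContinuousOn F (Set.Icc 0 1) := by fun_prop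
  have hF1 : F 1 = F 0 + 4 * Real.pi := by simp only [hF, hθ1]; ring
  have hpi := Real.pi_pos
  -- The least `n` with `π + 2πn ≥ F 0`; this value is below `F 0 + 2π`, hence attained.
  set n : ℤ := ⌈(F 0 - Real.pi) / (2 * Real.pi)⌉
  have hn1 : F 0 - Real.pi ≤ n * (2 * Real.pi) := (div_le_iff₀ (by positivity)).1 (Int.le_ceil _)
  have hn2 : n * (2 * Real.pi) < F 0 - Real.pi + 2 * Real.pi := by
    have h1 : (n : ℝ) < (F 0 - Real.pi) / (2 * Real.pi) + 1 := Int.ceil_lt_add_one _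
    have h2 := mul_lt_mul_of_pos_right h1 (show 0 < 2 * Real.pi by positivity)
    rwa [add_mul, div_mul_cancel₀ _ (by positivity), one_mul] at h2
  obtain ⟨t, ht, hFt⟩ := intermediate_value_Icc zero_le_one hFc
    (show Real.pi + n * (2 * Real.pi) ∈ Set.Icc (F 0) (F 1) by
      constructor <;> linarith)
  set z : ℂ := r * Complex.exp (2 * Real.pi * Complex.I * t) with hz
  have hzn : ‖z‖ = r := by
    rw [hz, norm_mul, Complex.norm_real, Real.norm_eq_abs, abs_of_pos hr]
    have : (2 * Real.pi * Complex.I * t : ℂ) = (2 * Real.pi * t : ℝ) * Complex.I := by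
      push_cast; ring
    rw [this, Complex.norm_exp_ofReal_mul_I, mul_one]
  have h1 := hball z (by simpa [hzn] using hrδ)
  have h2 := hθ t ht
  rw [← hz] at h2
  set N : ℝ := ‖h z - h 0‖
  have hexp : Complex.exp (-(F t : ℂ) * Complex.I) = -1 := by
    rw [hFt]
    push_cast
    have : -((Real.pi : ℂ) + n * (2 * Real.pi)) * Complex.I =
        -(Real.pi * Complex.I) - n * (2 * Real.pi * Complex.I) := by ring
    rw [this, Complex.exp_sub, Complex.exp_neg, Complex.exp_pi_mul_I,
      Complex.exp_int_mul_two_pi_mul_I]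
    norm_num
  have hbe : b = ‖b‖ * Complex.exp (b.arg * Complex.I) := (Complex.norm_mul_exp_arg_mul_I b).symm
  -- The unit factor that turns `b z` onto the positive real axis.
  set w : ℂ := Complex.exp (-(2 * Real.pi * t + b.arg : ℝ) * Complex.I) with hw
  have hwn : ‖w‖ = 1 := by
    rw [hw, ← Complex.ofReal_neg, Complex.norm_exp_ofReal_mul_I]
  have h3 : starRingEnd ℂ (h z - h 0) * w = -N := by
    rw [h2, map_mul, Complex.conj_ofReal, ← Complex.exp_conj, mul_assoc, hw, ← Complex.exp_add]
    have : starRingEnd ℂ (2 * Real.pi * Complex.I * θ t) +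
        -((2 * Real.pi * t + b.arg : ℝ) : ℂ) * Complex.I = -(F t : ℂ) * Complex.I := by
      simp only [map_mul, Complex.conj_I, Complex.conj_ofReal, map_ofNat, hF]
      push_cast
      ring
    rw [this, hexp]
    ring
  have h4 : z * b * w = r * ‖b‖ := by
    have : Complex.exp (2 * Real.pi * Complex.I * t) * Complex.exp (b.arg * Complex.I) * w = 1 := by
      rw [hw, ← Complex.exp_add, ← Complex.exp_add, ← Complex.exp_zero]
      congr 1
      push_cast
      ring
    rw [hz]
    nth_rw 1 [hbe]
    linear_combination (r : ℂ) * ‖b‖ * this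
  have h5 : ‖(starRingEnd ℂ (h z) - starRingEnd ℂ (h 0) - (z - 0) • b) * w‖ = N + r * ‖b‖ := by
    have : (starRingEnd ℂ (h z) - starRingEnd ℂ (h 0) - (z - 0) • b) * w =
        -((N + r * ‖b‖ : ℝ) : ℂ) := by
      rw [← map_sub, sub_zero, smul_eq_mul, sub_mul, h3, h4]
      push_cast
      ring
    rw [this, norm_neg, Complex.norm_real, Real.norm_eq_abs, abs_of_nonneg]
    positivity
  rw [norm_mul, hwn, mul_one] at h5
  have h6 : N + r * ‖b‖ ≤ ‖b‖ / 2 * ‖z - 0‖ := h5 ▸ h1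
  rw [sub_zero, hzn] at h6
  have h7 : 0 ≤ N := norm_nonneg _
  have h8 : 0 < r * ‖b‖ := mul_pos hr hbn
  linarith

/-! ### Standard actions and the conclusion -/

namespace HolCircleAction

theorem IsStandard.linearizes {γ : HolCircleAction} (hγ : γ.IsStandard) :
    γ.Linearizes 0 id 1 where
  analyticAt := analyticAt_id
  map_eq_zero := rfl
  deriv_ne_zero := by simp
  sign := Or.inl rfl
  equivariant := by
    filter_upwards [γ.isOpen_domain.mem_nhds γ.zero_mem] with z hz t
    rw [id, id, hγ t z hz]
    congr 2
    push_cast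
    ring

/-- The half turn gives `p = -p`. Applied to `h 0`, this lets the identity serve as linearizing
coordinate on the target side. -/
theorem IsStandard.eq_zero_of_fixed {γ : HolCircleAction} (hγ : γ.IsStandard) {p : ℂ}
    (hp : p ∈ γ.domain) (hfix : ∀ t, γ.act t p = p) : p = 0 := by
  have h1 := hγ 2⁻¹ p hp
  have h2 : (2 * Real.pi * Complex.I * ((2⁻¹ : ℝ) : ℂ) : ℂ) = Real.pi * Complex.I := by
    push_cast
    ring
  rw [hfix, h2, Complex.exp_pi_mul_I] at h1
  linear_combination h1 / 2

end HolCircleAction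

theorem mainTheorem8 (γ ρ γ' ρ' : HolCircleAction)
    (hγρ : HolCircleAction.NontrivialPair γ ρ) (hγρ' : HolCircleAction.NontrivialPair γ' ρ')
    (h : OpenPartialHomeomorph ℂ ℂ) (h0 : (0 : ℂ) ∈ h.source)
    (hγ : HolCircleAction.Equivariant γ γ' h) (hρ : HolCircleAction.Equivariant ρ ρ' h) :
    (HolomorphicNearZero h ∨ AntiholomorphicNearZero h) ∧
    (OrientationPreservingAtZero h → HolomorphicNearZero h) ∧
    (γ.IsStandard → γ'.IsStandard →
      ((∃ l : ℂ, l ≠ 0 ∧ ∀ᶠ z in 𝓝 (0 : ℂ), h z = l * z) ∨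
        (∃ l : ℂ, l ≠ 0 ∧ ∀ᶠ z in 𝓝 (0 : ℂ), h z = l * (starRingEnd ℂ) z)) ∧
      (OrientationPreservingAtZero h →
        ∃ l : ℂ, l ≠ 0 ∧ ∀ᶠ z in 𝓝 (0 : ℂ), h z = l * z)) := by
  have hh : ContinuousAt h 0 := h.continuousAt h0
  obtain ⟨hd, hfix, -⟩ := hγ.exists_sign
  have hconj : ∀ {φ φ' : ℂ → ℂ} {ε ε' : ℝ}, γ.Linearizes 0 φ ε → γ'.Linearizes (h 0) φ' ε' →
      (∃ c : ℂ, c ≠ 0 ∧ ∀ᶠ z in 𝓝 (0 : ℂ), starRingEnd ℂ (φ' (h z)) = c * φ z) →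
      AnalyticAt ℂ (fun z => starRingEnd ℂ (h z)) 0 ∧
        deriv (fun z => starRingEnd ℂ (h z)) 0 ≠ 0 := by
    rintro φ φ' ε ε' hφ hφ' ⟨c, hc, hcz⟩
    refine analyticAt_of_comp_eq (F := starRingEnd ℂ ∘ φ' ∘ starRingEnd ℂ)
      (Complex.continuous_conj.continuousAt.comp hh) hφ'.analyticAt.conj_comp_conj
      (by simp [hφ'.map_eq_zero]) (by rw [deriv_conj_conj]; simpa using hφ'.deriv_ne_zero)
      hφ.analyticAt hφ.map_eq_zero hφ.deriv_ne_zero hc ?_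
    simpa only [Function.comp_apply, Complex.conj_conj] using hcz
  have hno : ∀ {φ φ' : ℂ → ℂ} {ε ε' : ℝ}, γ.Linearizes 0 φ ε → γ'.Linearizes (h 0) φ' ε' →
      (∃ c : ℂ, c ≠ 0 ∧ ∀ᶠ z in 𝓝 (0 : ℂ), starRingEnd ℂ (φ' (h z)) = c * φ z) →
      ¬ OrientationPreservingAtZero h := fun hφ hφ' hc =>
    not_orientationPreservingAtZero (hconj hφ hφ' hc).1.differentiableAt.hasDerivAt
      (hconj hφ hφ' hc).2
  obtain ⟨φ, ε, hφ⟩ := γ.exists_linearizes γ.zero_mem γ.fixes_zero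
  obtain ⟨φ', ε', hφ'⟩ := γ'.exists_linearizes hd hfix
  have hmain : HolomorphicNearZero h ∨ (AntiholomorphicNearZero h ∧
      ¬ OrientationPreservingAtZero h) := by
    rcases HolCircleAction.eq_mul_or_conj_eq_mul hγρ h h0 hγ hρ hφ hφ' with ⟨c, hc, hcz⟩ | hcz
    · exact Or.inl ((analyticAt_of_comp_eq hh hφ'.analyticAt hφ'.map_eq_zero hφ'.deriv_ne_zero
        hφ.analyticAt hφ.map_eq_zero hφ.deriv_ne_zero hc hcz).1.eventually_analyticAt.mono
        fun z hz => hz.differentiableAt)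
    · exact Or.inr ⟨(hconj hφ hφ' hcz).1.eventually_analyticAt.mono
        fun z hz => hz.differentiableAt, hno hφ hφ' hcz⟩
  refine ⟨hmain.imp_right And.left, fun hor => hmain.resolve_right fun hcon => hcon.2 hor, ?_⟩
  intro hst hst'
  have hst0 : γ'.Linearizes (h 0) id 1 := by
    rw [hst'.eq_zero_of_fixed hd hfix]
    exact hst'.linearizes
  -- With the identity as both coordinates, linearity in coordinates is the explicit form of `h`.
  have hlin := HolCircleAction.eq_mul_or_conj_eq_mul hγρ h h0 hγ hρ hst.linearizes hst0
  refine ⟨hlin.imp_right ?_, fun hor => hlin.resolve_right fun hcon =>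
    hno hst.linearizes hst0 hcon hor⟩
  rintro ⟨c, hc, hcz⟩
  refine ⟨starRingEnd ℂ c, by simpa using hc, hcz.mono fun z hz => ?_⟩
  rw [← map_mul, ← Complex.conj_conj (h z)]
  exact congrArg _ hz
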